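/- Let $n\ge 1$, $p\ge 0$, let $\mathcal Z$ be a set of possible data points, $\Theta\subseteq\mathbb R^p$, and let $\Psi:\mathbb R^p\times\mathcal Z\to\mathbb R^p$ (for instance the gradient $\Psi(\theta,z)=\nabla_\theta\rho(\theta,z)$ of a loss function $\rho$) be measurable in its first argument and satisfy $\sup_{\theta\in\Theta,\,z\in\mathcal Z}\|\Psi(\theta,z)\|_2\le B_0$ for a constant $B_0>0$. Let $\gamma_1,\dots,\gamma_n\in\mathbb R$ be step sizes, let $\mu_1,\dots,\mu_n>0$, and let $\xi_1,\dots,\xi_n$ be i.i.d. standard Gaussian random vectors in $\mathbb R^p$. For an initial value $\hat\theta_0\in\mathbb R^p$ and a data set $(z_1,\dots,z_n)\in\mathcal Z^n$ define $$\hat\theta_i=\hat\theta_{i-1}-\gamma_i\Big\{\Psi(\hat\theta_{i-1},z_i)+\frac{2B_0}{\mu_i}\,\xi_i\Big\},\quad i=1,\dots,n,\qquad \bar\theta_n=\frac1n\sum_{i=1}^n\hat\theta_i .$$ Assume that for every data set $\hat\theta_0,\dots,\hat\theta_{n-1}$ lie in $\Theta$ almost surely (which is automatic if $\Theta=\mathbb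 R^p$). Then the randomized algorithm $(z_1,\dots,z_n)\mapsto\bar\theta_n$ is $\max\{\mu_1,\dots,\mu_n\}$-GDP. Here, for probability measures $P,Q$ on the same space and $\alpha\in[0,1]$, $T(P,Q)(\alpha)=\inf_\varphi\{1-\int\varphi\,dQ:\int\varphi\,dP\le\alpha\}$, the infimum being over measurable $\varphi$ with values in $[0,1]$; and a randomized algorithm $M$ is $\mu$-GDP ($\mu$-Gaussian differentially private) if, for all data sets $z,z'$ of the same size that differ in one entry and all $\alpha\in[0,1]$, the laws of the outputs satisfy $T(M(z),M(z'))(\alpha)\ge T(\mathcal N(0,1),\mathcal N(\mu,1))(\alpha)$. -/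

import Mathlib

open MeasureTheory ProbabilityTheory

noncomputable section

namespace LDPSGD

/-- A (randomized) test: a measurable function with values in `[0, 1]`, where `φ x` is the
probability of rejecting the null hypothesis after observing `x`. -/
def IsTest {X : Type*} [MeasurableSpace X] (φ : X → ℝ) : Prop :=
  Measurable φ ∧ ∀ x, φ x ∈ Set.Icc (0 : ℝ) 1

/-- The trade-off function `T(P, Q)`: the smallest type II error against the alternative `Q` among
all tests whose type I error under `P` is at most `α` (for `α ∈ [0, 1]`). -/
def tradeoff {X : Type*} [MeasurableSpace X] (P Q : Measure X) (α : ℝ) : ℝ :=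
  sInf {β : ℝ | ∃ φ : X → ℝ, IsTest φ ∧ ∫ x, φ x ∂P ≤ α ∧ β = ∫ x, (1 - φ x) ∂Q}

/-- `G_μ = T(N(0, 1), N(μ, 1))`. -/
def gaussianTradeoff (μ α : ℝ) : ℝ :=
  tradeoff (gaussianReal 0 1) (gaussianReal μ 1) α

/-- Two data sets of the same size differ in (at most) one entry. -/
def Neighboring {n : ℕ} {Z : Type*} (z z' : Fin n → Z) : Prop :=
  ∃ i, ∀ j, j ≠ i → z j = z' j

/-- `μ`-Gaussian differential privacy of a randomized algorithm, where `M z` is the law of the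
output on the data set `z`: `T(M z, M z') ≥ G_μ` on `[0, 1]` for all neighboring `z`, `z'`. -/
def IsGDP {n : ℕ} {Z X : Type*} [MeasurableSpace X] (μ : ℝ) (M : (Fin n → Z) → Measure X) : Prop :=
  ∀ z z' : Fin n → Z, Neighboring z z' →
    ∀ α ∈ Set.Icc (0 : ℝ) 1, gaussianTradeoff μ α ≤ tradeoff (M z) (M z') α

/-- The noisy SGD iterates `θ̂_0, …, θ̂_n` for the data `z` and the noise realization `ξ`:
`θ̂_{i+1} = θ̂_i - γ_{i+1} (Ψ(θ̂_i, z_{i+1}) + (2 B₀ / μ_{i+1}) ξ_{i+1})`. The quantities indexed by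
`1, …, n` in the mathematical notation are indexed by `Fin n`, that is by `0, …, n - 1`. -/
def iterate {n p : ℕ} {Z : Type*}
    (Ψ : EuclideanSpace ℝ (Fin p) → Z → EuclideanSpace ℝ (Fin p)) (B₀ : ℝ) (γ μ : Fin n → ℝ)
    (θ₀ : EuclideanSpace ℝ (Fin p)) (z : Fin n → Z) (ξ : Fin n → EuclideanSpace ℝ (Fin p)) :
    Fin (n + 1) → EuclideanSpace ℝ (Fin p) :=
  Fin.induction θ₀ fun i θ => θ - γ i • (Ψ θ (z i) + (2 * B₀ / μ i) • ξ i)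

/-- The averaged output `(θ̂_1 + ⋯ + θ̂_n) / n`. -/
def average {n p : ℕ} {Z : Type*}
    (Ψ : EuclideanSpace ℝ (Fin p) → Z → EuclideanSpace ℝ (Fin p)) (B₀ : ℝ) (γ μ : Fin n → ℝ)
    (θ₀ : EuclideanSpace ℝ (Fin p)) (z : Fin n → Z) (ξ : Fin n → EuclideanSpace ℝ (Fin p)) :
    EuclideanSpace ℝ (Fin p) :=
  (n : ℝ)⁻¹ • ∑ i : Fin n, iterate Ψ B₀ γ μ θ₀ z ξ i.succ

end LDPSGD

end

/-! Suppose the data differ only at index `i`. The difference of the two gradients at `θ̂_{i-1}` can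
be absorbed into the noise `ξ_i` by a translation by a vector of norm at most `μ_i`, which depends
only on the earlier noise; after this translation the two runs coincide. Splitting `ξ_i`
along the translation as `x • u + (1 - u uᵀ)^{1/2} g` with `‖u‖ ≤ 1`, a standard real Gaussian `x`
and an independent standard Gaussian `g`, the translation of `ξ_i` becomes a translation of `x`.
Hence both runs are obtained from `N(0, 1)` and `N(m, 1)`, `m = max_i μ_i`, by the same randomized
post-processing, and post-processing cannot decrease a trade-off function. -/

namespace LDPSGD

section PostProcessing

variable {X Y : Type*} [MeasurableSpace X] [MeasurableSpace Y]

theorem IsTest.integrable {φ : X → ℝ} (hφ : IsTest φ) (P : Measure X) [IsFiniteMeasure P] :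
    Integrable φ P :=
  .of_mem_Icc 0 1 hφ.1.aemeasurable (.of_forall hφ.2)

theorem IsTest.one_sub {φ : X → ℝ} (hφ : IsTest φ) : IsTest fun x => 1 - φ x :=
  ⟨hφ.1.const_sub 1, fun x => Set.Icc.one_sub_mem (hφ.2 x)⟩

theorem IsTest.integral_kernel {φ : Y → ℝ} (hφ : IsTest φ) (κ : Kernel X Y) [IsMarkovKernel κ] :
    IsTest fun x => ∫ y, φ y ∂κ x := by
  refine ⟨hφ.1.stronglyMeasurable.integral_kernel.measurable, fun x =>
    ⟨integral_nonneg fun y => (hφ.2 y).1, ?_⟩⟩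
  simpa using integral_mono (hφ.integrable (κ x)) (integrable_const 1) fun y => (hφ.2 y).2

theorem IsTest.integral_comp {φ : Y → ℝ} (hφ : IsTest φ) (P : Measure X) [IsFiniteMeasure P]
    (κ : Kernel X Y) [IsMarkovKernel κ] :
    ∫ y, φ y ∂(κ ∘ₘ P) = ∫ x, ∫ y, φ y ∂κ x ∂P := by
  have hκ := hφ.integrable (κ ∘ₘ P)
  rw [Measure.comp_eq_comp_const_apply] at hκ ⊢
  rw [Kernel.integral_comp hκ, Kernel.const_apply]

theorem tradeoff_le_tradeoff_comp (P Q : Measure X) [IsFiniteMeasure P] [IsFiniteMeasure Q]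
    (κ : Kernel X Y) [IsMarkovKernel κ] {α : ℝ} (hα : 0 ≤ α) :
    tradeoff P Q α ≤ tradeoff (κ ∘ₘ P) (κ ∘ₘ Q) α := by
  refine csInf_le_csInf ⟨0, ?_⟩ ⟨_, 0, ⟨measurable_const, by simp⟩, by simpa using hα, rfl⟩ ?_
  · rintro _ ⟨φ, hφ, -, rfl⟩
    exact integral_nonneg fun x => (hφ.one_sub.2 x).1
  · rintro _ ⟨φ, hφ, hle, rfl⟩
    refine ⟨fun x => ∫ y, φ y ∂κ x, hφ.integral_kernel κ, ?_, ?_⟩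
    · rwa [← hφ.integral_comp]
    · rw [hφ.one_sub.integral_comp]
      simp [integral_sub (integrable_const 1) (hφ.integrable _)]

theorem tradeoff_le_tradeoff_map (P Q : Measure X) [IsFiniteMeasure P] [IsFiniteMeasure Q]
    {f : X → Y} (hf : Measurable f) {α : ℝ} (hα : 0 ≤ α) :
    tradeoff P Q α ≤ tradeoff (P.map f) (Q.map f) α := by
  simpa only [Measure.deterministic_comp_eq_map] using
    tradeoff_le_tradeoff_comp P Q (Kernel.deterministic f hf) hα

theorem tradeoff_le_tradeoff_prod (P Q : Measure X) [IsFiniteMeasure P] [IsFiniteMeasure Q]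
    (R : Measure Y) [IsProbabilityMeasure R] {α : ℝ} (hα : 0 ≤ α) :
    tradeoff P Q α ≤ tradeoff (P.prod R) (Q.prod R) α := by
  simpa only [← Measure.compProd_eq_comp_prod, Measure.compProd_const] using
    tradeoff_le_tradeoff_comp P Q (Kernel.id ×ₖ Kernel.const X R) hα

theorem IsGDP.map {n : ℕ} {Z : Type*} {μ : ℝ} {M : (Fin n → Z) → Measure X}
    [∀ z, IsFiniteMeasure (M z)] (hM : IsGDP μ M) {f : X → Y} (hf : Measurable f) :
    IsGDP μ fun z => (M z).map f :=
  fun z z' hz α hα => (hM z z' hz α hα).trans (tradeoff_le_tradeoff_map _ _ hf hα.1)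

theorem gaussianTradeoff_le_tradeoff_of_translate {W : Type*} [MeasurableSpace W]
    {ν : Measure W} [IsProbabilityMeasure ν] {P : Measure X} {V : ℝ × W → X}
    (hV : MeasurePreserving V ((gaussianReal 0 1).prod ν) P)
    {f g : X → Y} (hf : Measurable f) (hg : Measurable g) {m : ℝ}
    (hfg : ∀ᵐ w ∂ν, ∀ t, f (V (t + m, w)) = g (V (t, w))) {α : ℝ} (hα : 0 ≤ α) :
    gaussianTradeoff m α ≤ tradeoff (P.map f) (P.map g) α := by
  have hshift : MeasurePreserving (Prod.map (· + m) id)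
      ((gaussianReal 0 1).prod ν) ((gaussianReal m 1).prod ν) :=
    MeasurePreserving.prod ⟨by fun_prop, by rw [gaussianReal_map_add_const, zero_add]⟩ (.id ν)
  have hf_map : ((gaussianReal 0 1).prod ν).map (f ∘ V) = P.map f := by
    rw [← Measure.map_map hf hV.measurable, hV.map_eq]
  have hg_map : ((gaussianReal m 1).prod ν).map (f ∘ V) = P.map g := by
    rw [← hshift.map_eq, Measure.map_map (hf.comp hV.measurable) hshift.measurable, ← hV.map_eq,
      Measure.map_map hg hV.measurable]
    refine Measure.map_congr ?_
    filter_upwards [Measure.quasiMeasurePreserving_snd.ae hfg] with q hq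
    exact hq q.1
  calc
    gaussianTradeoff m α
      ≤ tradeoff ((gaussianReal 0 1).prod ν) ((gaussianReal m 1).prod ν) α :=
        tradeoff_le_tradeoff_prod _ _ ν hα
    _ ≤ tradeoff (((gaussianReal 0 1).prod ν).map (f ∘ V))
          (((gaussianReal m 1).prod ν).map (f ∘ V)) α :=
        tradeoff_le_tradeoff_map _ _ (hf.comp hV.measurable) hα
    _ = tradeoff (P.map f) (P.map g) α := by rw [hf_map, hg_map]

end PostProcessing

section GaussianSplitting

open ContinuousLinearMap InnerProductSpace

variable {E F G : Type*}
  [NormedAddCommGroup E] [InnerProductSpace ℝ E]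
  [NormedAddCommGroup F] [InnerProductSpace ℝ F]
  [NormedAddCommGroup G] [InnerProductSpace ℝ G]

/-- The square root `(1 - v vᵀ)^{1/2}` of the covariance that remains when the direction `v`,
`‖v‖ ≤ 1`, is split off from a standard Gaussian vector. The explicit form makes its measurable
dependence on `v` evident. -/
noncomputable def sqrtOneSubRankOne (v : E) : E →L[ℝ] E :=
  1 - (1 + √(1 - ‖v‖ ^ 2))⁻¹ • rankOne ℝ v v

theorem sqrtOneSubRankOne_apply (v t : E) :
    sqrtOneSubRankOne v t = t - ((1 + √(1 - ‖v‖ ^ 2))⁻¹ * inner ℝ v t) • v := by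
  simp [sqrtOneSubRankOne, mul_smul]

theorem norm_sqrtOneSubRankOne_apply_sq {v : E} (hv : ‖v‖ ≤ 1) (t : E) :
    ‖sqrtOneSubRankOne v t‖ ^ 2 = ‖t‖ ^ 2 - inner ℝ v t ^ 2 := by
  have hsq : ‖v‖ ^ 2 = 1 - √(1 - ‖v‖ ^ 2) ^ 2 := by
    rw [Real.sq_sqrt (by nlinarith [norm_nonneg v])]
    ring
  have hne : 1 + √(1 - ‖v‖ ^ 2) ≠ 0 := by positivity
  rw [sqrtOneSubRankOne_apply, norm_sub_sq_real, norm_smul, mul_pow, Real.norm_eq_abs, sq_abs,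
    real_inner_smul_right, real_inner_comm v t]
  generalize √(1 - ‖v‖ ^ 2) = s at hsq hne ⊢
  rw [hsq]
  field_simp
  ring

theorem adjoint_sqrtOneSubRankOne [CompleteSpace E] (v : E) :
    adjoint (sqrtOneSubRankOne v) = sqrtOneSubRankOne v := by
  simp [sqrtOneSubRankOne, adjoint_one]

theorem measurable_smul_add_sqrtOneSubRankOne [MeasurableSpace E] [BorelSpace E]
    [SecondCountableTopology E] {X : Type*} [MeasurableSpace X] {u : X → E} (hu : Measurable u) :
    Measurable fun r : X × ℝ × E => r.2.1 • u r.1 + sqrtOneSubRankOne (u r.1) r.2.2 := by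
  simp only [sqrtOneSubRankOne_apply]
  fun_prop

variable [FiniteDimensional ℝ E] [FiniteDimensional ℝ F] [FiniteDimensional ℝ G]
  [MeasurableSpace E] [BorelSpace E] [MeasurableSpace F] [BorelSpace F]
  [MeasurableSpace G] [BorelSpace G]

theorem charFun_map_stdGaussian (A : E →L[ℝ] F) (t : F) :
    charFun ((stdGaussian E).map A) t = Complex.exp (-‖adjoint A t‖ ^ 2 / 2) := by
  rw [charFun_apply, integral_map (by fun_prop) (by fun_prop)]
  simp_rw [← adjoint_inner_right]
  rw [← charFun_apply, charFun_stdGaussian]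

theorem map_prod_stdGaussian {A : E →L[ℝ] G} {B : F →L[ℝ] G}
    (h : ∀ t, ‖adjoint A t‖ ^ 2 + ‖adjoint B t‖ ^ 2 = ‖t‖ ^ 2) :
    ((stdGaussian E).prod (stdGaussian F)).map (fun q => A q.1 + B q.2) = stdGaussian G := by
  have hconv : ((stdGaussian E).prod (stdGaussian F)).map (fun q => A q.1 + B q.2) =
      (stdGaussian E).map A ∗ (stdGaussian F).map B := by
    rw [Measure.conv, Measure.map_prod_map _ _ (by fun_prop) (by fun_prop),
      Measure.map_map (by fun_prop) (by fun_prop)]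
    rfl
  rw [hconv]
  refine Measure.ext_of_charFun (funext fun t => ?_)
  rw [charFun_conv, charFun_map_stdGaussian, charFun_map_stdGaussian, charFun_stdGaussian,
    ← Complex.exp_add]
  congr 1
  exact_mod_cast (by linear_combination -h t / 2 :
    -‖adjoint A t‖ ^ 2 / 2 + -‖adjoint B t‖ ^ 2 / 2 = -‖t‖ ^ 2 / 2)

theorem stdGaussian_real_eq_gaussianReal : stdGaussian ℝ = gaussianReal 0 1 :=
  Measure.ext_of_charFun <| funext fun t => by
    simp [charFun_stdGaussian, charFun_gaussianReal, neg_div, ← Complex.ofReal_pow]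

theorem map_smul_add_sqrtOneSubRankOne {v : E} (hv : ‖v‖ ≤ 1) :
    ((gaussianReal 0 1).prod (stdGaussian E)).map
      (fun q => q.1 • v + sqrtOneSubRankOne v q.2) = stdGaussian E := by
  rw [← stdGaussian_real_eq_gaussianReal]
  refine map_prod_stdGaussian (A := toSpanSingleton ℝ v) fun t => ?_
  rw [adjoint_sqrtOneSubRankOne, norm_sqrtOneSubRankOne_apply_sq hv, adjoint_toSpanSingleton]
  simp

end GaussianSplitting

section Resampling

variable {ι : Type*} [Fintype ι] [DecidableEq ι] {E : ι → Type*} [∀ j, MeasurableSpace (E j)]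
  (ρ : ∀ j, Measure (E j))

theorem measurePreserving_update [∀ j, SigmaFinite (ρ j)] (i : ι) [IsProbabilityMeasure (ρ i)] :
    MeasurePreserving (fun q : (∀ j, E j) × E i => Function.update q.1 i q.2)
      ((Measure.pi ρ).prod (ρ i)) (Measure.pi ρ) := by
  have hm : Measurable fun q : (∀ j, E j) × E i => Function.update q.1 i q.2 := measurable_update'
  refine ⟨hm, (Measure.pi_eq fun s hs => ?_).symm⟩
  have hpre : (fun q : (∀ j, E j) × E i => Function.update q.1 i q.2) ⁻¹' Set.univ.pi s =
      Set.univ.pi (Function.update s i Set.univ) ×ˢ s i := by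
    ext q
    simp only [Set.mem_preimage, Set.mem_prod, Set.mem_univ_pi]
    grind
  have hne (j : ι) (hj : j ∈ Finset.univ.erase i) :
      ρ j (Function.update s i Set.univ j) = ρ j (s j) := by
    rw [Function.update_of_ne (Finset.ne_of_mem_erase hj)]
  rw [Measure.map_apply hm (.univ_pi hs), hpre, Measure.prod_prod, Measure.pi_pi,
    ← Finset.prod_erase_mul _ _ (Finset.mem_univ i), Finset.prod_congr rfl hne,
    Function.update_self, measure_univ, mul_one,
    Finset.prod_erase_mul _ (fun j => ρ j (s j)) (Finset.mem_univ i)]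

theorem measurePreserving_update_of_map_eq {A : Type*} [MeasurableSpace A] (ν : Measure A)
    [SFinite ν] [∀ j, SigmaFinite (ρ j)] {i : ι} [IsProbabilityMeasure (ρ i)]
    {T : (∀ j, E j) → A → E i} (hT : Measurable (Function.uncurry T))
    (hTρ : ∀ᵐ x ∂Measure.pi ρ, ν.map (T x) = ρ i) :
    MeasurePreserving (fun q : A × (∀ j, E j) => Function.update q.2 i (T q.2 q.1))
      (ν.prod (Measure.pi ρ)) (Measure.pi ρ) :=
  (measurePreserving_update ρ i).comp <|
    ((MeasurePreserving.id _).skew_product hT hTρ).comp Measure.measurePreserving_swap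

theorem gaussianTradeoff_le_tradeoff_of_update_add [∀ j, IsProbabilityMeasure (ρ j)] {i : ι}
    [NormedAddCommGroup (E i)] [InnerProductSpace ℝ (E i)] [FiniteDimensional ℝ (E i)]
    [BorelSpace (E i)] (hρ : ρ i = stdGaussian (E i)) {Y : Type*} [MeasurableSpace Y]
    {f g : (∀ j, E j) → Y} (hf : Measurable f) (hg : Measurable g)
    {v : (∀ j, E j) → E i} (hv : Measurable v) {m : ℝ} (hvm : ∀ᵐ x ∂Measure.pi ρ, ‖v x‖ ≤ m)
    (hfg : ∀ᵐ x ∂Measure.pi ρ, ∀ y, f (Function.update x i (y + v x)) = g (Function.update x i y))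
    {α : ℝ} (hα : 0 ≤ α) :
    gaussianTradeoff m α ≤ tradeoff ((Measure.pi ρ).map f) ((Measure.pi ρ).map g) α := by
  obtain ⟨x₀, hx₀⟩ := hvm.exists
  have hm : 0 ≤ m := (norm_nonneg _).trans hx₀
  let u (x : ∀ j, E j) : E i := m⁻¹ • v x
  have hu : ∀ᵐ x ∂Measure.pi ρ, ‖u x‖ ≤ 1 ∧ m • u x = v x := by
    filter_upwards [hvm] with x hx
    constructor
    · rw [norm_smul, norm_inv, Real.norm_of_nonneg hm]
      exact inv_mul_le_one_of_le₀ hx hm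
    · obtain rfl | hm' := eq_or_ne m 0
      · simpa using (norm_le_zero_iff.1 hx).symm
      · exact smul_inv_smul₀ hm' _
  let T (x : ∀ j, E j) (q : ℝ × E i) : E i := q.1 • u x + sqrtOneSubRankOne (u x) q.2
  have hT : MeasurePreserving
      (fun q : (ℝ × E i) × (∀ j, E j) => Function.update q.2 i (T q.2 q.1))
      (((gaussianReal 0 1).prod (stdGaussian (E i))).prod (Measure.pi ρ)) (Measure.pi ρ) := by
    refine measurePreserving_update_of_map_eq ρ _
      (measurable_smul_add_sqrtOneSubRankOne (hv.const_smul _)) ?_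
    filter_upwards [hu] with x hx
    rw [hρ]
    exact map_smul_add_sqrtOneSubRankOne hx.1
  have hassoc := measurePreserving_prodAssoc (gaussianReal 0 1) (stdGaussian (E i)) (Measure.pi ρ)
  refine gaussianTradeoff_le_tradeoff_of_translate (hT.comp hassoc.symm) hf hg ?_ hα
  filter_upwards [Measure.quasiMeasurePreserving_snd.ae hu,
    Measure.quasiMeasurePreserving_snd.ae hfg] with w hw hw' t
  have hTv : T w.2 (t + m, w.1) = T w.2 (t, w.1) + v w.2 := by
    simp only [T, add_smul, hw.2]
    abel
  exact (congrArg (fun y => f (Function.update w.2 i y)) hTv).trans (hw' _)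

end Resampling

section Iterate

variable {n p : ℕ} {Z : Type*} {Ψ : EuclideanSpace ℝ (Fin p) → Z → EuclideanSpace ℝ (Fin p)}
  {B₀ : ℝ} {γ μ : Fin n → ℝ} {θ₀ : EuclideanSpace ℝ (Fin p)}

theorem iterate_succ (z : Fin n → Z) (ξ : Fin n → EuclideanSpace ℝ (Fin p)) (i : Fin n) :
    iterate Ψ B₀ γ μ θ₀ z ξ i.succ = iterate Ψ B₀ γ μ θ₀ z ξ i.castSucc -
      γ i • (Ψ (iterate Ψ B₀ γ μ θ₀ z ξ i.castSucc) (z i) + (2 * B₀ / μ i) • ξ i) :=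
  rfl

theorem measurable_iterate (hΨ : ∀ z, Measurable fun θ => Ψ θ z) (z : Fin n → Z) :
    Measurable (iterate Ψ B₀ γ μ θ₀ z) := by
  refine measurable_pi_lambda _ fun j => ?_
  induction j using Fin.induction with
  | zero => exact measurable_const
  | succ i ih =>
    have := (hΨ (z i)).comp ih
    simp only [iterate_succ]
    fun_prop

theorem measurable_gradient_sub_gradient (hΨ : ∀ z, Measurable fun θ => Ψ θ z) (z : Fin n → Z)
    (j : Fin (n + 1)) (y y' : Z) :
    Measurable fun ξ => Ψ (iterate Ψ B₀ γ μ θ₀ z ξ j) y - Ψ (iterate Ψ B₀ γ μ θ₀ z ξ j) y' :=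
  ((hΨ y).sub (hΨ y')).comp (measurable_pi_iff.1 (measurable_iterate hΨ z) j)

theorem iterate_congr {z z' : Fin n → Z} {ξ ξ' : Fin n → EuclideanSpace ℝ (Fin p)}
    {j : Fin (n + 1)}
    (h : ∀ k : Fin n, k.castSucc < j →
      Ψ (iterate Ψ B₀ γ μ θ₀ z ξ k.castSucc) (z k) + (2 * B₀ / μ k) • ξ k =
        Ψ (iterate Ψ B₀ γ μ θ₀ z ξ k.castSucc) (z' k) + (2 * B₀ / μ k) • ξ' k) :
    iterate Ψ B₀ γ μ θ₀ z ξ j = iterate Ψ B₀ γ μ θ₀ z' ξ' j := by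
  induction j using Fin.induction with
  | zero => rfl
  | succ i ih =>
    rw [iterate_succ, iterate_succ, h i i.castSucc_lt_succ,
      ih fun k hk => h k (hk.trans i.castSucc_lt_succ)]

theorem iterate_update_castSucc (z : Fin n → Z) (ξ : Fin n → EuclideanSpace ℝ (Fin p))
    (i : Fin n) (y : EuclideanSpace ℝ (Fin p)) :
    iterate Ψ B₀ γ μ θ₀ z (Function.update ξ i y) i.castSucc =
      iterate Ψ B₀ γ μ θ₀ z ξ i.castSucc := by
  refine (iterate_congr fun k hk => ?_).symm
  rw [Function.update_of_ne (Fin.castSucc_lt_castSucc_iff.1 hk).ne]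

theorem iterate_update_add {z z' : Fin n → Z} {i : Fin n} (hz : ∀ j, j ≠ i → z j = z' j)
    {ξ : Fin n → EuclideanSpace ℝ (Fin p)} {w : EuclideanSpace ℝ (Fin p)}
    (hw : (2 * B₀ / μ i) • w = Ψ (iterate Ψ B₀ γ μ θ₀ z ξ i.castSucc) (z' i) -
      Ψ (iterate Ψ B₀ γ μ θ₀ z ξ i.castSucc) (z i)) (y : EuclideanSpace ℝ (Fin p)) :
    iterate Ψ B₀ γ μ θ₀ z (Function.update ξ i (y + w)) =
      iterate Ψ B₀ γ μ θ₀ z' (Function.update ξ i y) := by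
  refine funext fun j => iterate_congr fun k _ => ?_
  obtain rfl | hk := eq_or_ne k i
  · rw [iterate_update_castSucc, Function.update_self, Function.update_self, smul_add, hw]
    abel
  · rw [Function.update_of_ne hk, Function.update_of_ne hk, hz k hk]

theorem isGDP_map_iterate (hΨ : ∀ z, Measurable fun θ => Ψ θ z) (hB₀ : 0 < B₀)
    (hμ : ∀ i, 0 < μ i) {m : ℝ} (hm : ∀ i, μ i ≤ m)
    (hsens : ∀ (z : Fin n → Z) (i : Fin n) (y : Z), ∀ᵐ ξ ∂Measure.pi fun _ => stdGaussian _,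
      ‖Ψ (iterate Ψ B₀ γ μ θ₀ z ξ i.castSucc) y -
        Ψ (iterate Ψ B₀ γ μ θ₀ z ξ i.castSucc) (z i)‖ ≤ 2 * B₀) :
    IsGDP m fun z =>
      (Measure.pi fun _ : Fin n => stdGaussian _).map (iterate Ψ B₀ γ μ θ₀ z) := by
  rintro z z' ⟨i, hz⟩ α hα
  let v (ξ : Fin n → EuclideanSpace ℝ (Fin p)) : EuclideanSpace ℝ (Fin p) :=
    (2 * B₀ / μ i)⁻¹ • (Ψ (iterate Ψ B₀ γ μ θ₀ z ξ i.castSucc) (z' i) -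
      Ψ (iterate Ψ B₀ γ μ θ₀ z ξ i.castSucc) (z i))
  have hv : Measurable v := (measurable_gradient_sub_gradient hΨ z _ _ _).fun_const_smul _
  have hc : 0 < 2 * B₀ / μ i := div_pos (by positivity) (hμ i)
  refine gaussianTradeoff_le_tradeoff_of_update_add (i := i) _ rfl (measurable_iterate hΨ z)
    (measurable_iterate hΨ z') hv ?_
    (.of_forall fun ξ => iterate_update_add hz (smul_inv_smul₀ hc.ne' _)) hα.1
  filter_upwards [hsens z i (z' i)] with ξ hξ
  calc
    ‖v ξ‖ ≤ (2 * B₀ / μ i)⁻¹ * (2 * B₀) := by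
      rw [norm_smul, Real.norm_of_nonneg (inv_pos.2 hc).le]
      gcongr
    _ = μ i := by field_simp
    _ ≤ m := hm i

end Iterate

end LDPSGD

theorem proposition5_general {n p : ℕ} [NeZero n] {Z Ω : Type*} [MeasurableSpace Ω]
    (P : Measure Ω)
    (Θ : Set (EuclideanSpace ℝ (Fin p)))
    (Ψ : EuclideanSpace ℝ (Fin p) → Z → EuclideanSpace ℝ (Fin p))
    (hΨ : ∀ z, Measurable fun θ => Ψ θ z)
    (B₀ : ℝ) (hB₀ : 0 < B₀) (hsens : ∀ θ ∈ Θ, ∀ z z', ‖Ψ θ z - Ψ θ z'‖ ≤ 2 * B₀)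
    (γ μ : Fin n → ℝ) (hμ : ∀ i, 0 < μ i)
    (θ₀ : EuclideanSpace ℝ (Fin p))
    (ξ : Fin n → Ω → EuclideanSpace ℝ (Fin p))
    (hξ : ∀ i, HasLaw (ξ i) (stdGaussian (EuclideanSpace ℝ (Fin p))) P)
    (hindep : iIndepFun ξ P)
    (hΘ : ∀ (z : Fin n → Z) (i : Fin n),
      ∀ᵐ ω ∂P, LDPSGD.iterate Ψ B₀ γ μ θ₀ z (fun j => ξ j ω) i.castSucc ∈ Θ) :
    LDPSGD.IsGDP (Finset.univ.sup' Finset.univ_nonempty μ)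
      (fun z : Fin n → Z => P.map fun ω => LDPSGD.average Ψ B₀ γ μ θ₀ z fun j => ξ j ω) := by
  have hlaw := hindep.hasLaw_pi hξ
  have hmean : Measurable fun θ : Fin (n + 1) → EuclideanSpace ℝ (Fin p) =>
      (n : ℝ)⁻¹ • ∑ i : Fin n, θ i.succ := by
    fun_prop
  have hmap (z : Fin n → Z) :
      (P.map fun ω => LDPSGD.average Ψ B₀ γ μ θ₀ z fun j => ξ j ω) =
        ((Measure.pi fun _ => stdGaussian _).map (LDPSGD.iterate Ψ B₀ γ μ θ₀ z)).map
          fun θ => (n : ℝ)⁻¹ • ∑ i : Fin n, θ i.succ := by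
    have hiter := LDPSGD.measurable_iterate (B₀ := B₀) (γ := γ) (μ := μ) (θ₀ := θ₀) hΨ z
    rw [← hlaw.map_eq, Measure.map_map hmean hiter, AEMeasurable.map_map_of_aemeasurable
      (hmean.comp hiter).aemeasurable hlaw.aemeasurable]
    rfl
  simp only [hmap]
  refine (LDPSGD.isGDP_map_iterate hΨ hB₀ hμ
    (fun i => Finset.le_sup' μ (Finset.mem_univ i)) fun z i y => ?_).map hmean
  refine (hlaw.ae_iff (measurableSet_setOfPred.1 <| measurableSet_le
    (LDPSGD.measurable_gradient_sub_gradient hΨ z _ _ _).norm measurable_const)).1 ?_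
  filter_upwards [hΘ z i] with ω hω
  exact hsens _ hω _ _

theorem proposition5 {n p : ℕ} [NeZero n] {Z Ω : Type*} [MeasurableSpace Ω]
    (P : Measure Ω) [IsProbabilityMeasure P]
    (Θ : Set (EuclideanSpace ℝ (Fin p)))
    (Ψ : EuclideanSpace ℝ (Fin p) → Z → EuclideanSpace ℝ (Fin p))
    (hΨ : ∀ z, Measurable fun θ => Ψ θ z)
    (B₀ : ℝ) (hB₀ : 0 < B₀) (hbound : ∀ θ ∈ Θ, ∀ z, ‖Ψ θ z‖ ≤ B₀)
    (γ μ : Fin n → ℝ) (hμ : ∀ i, 0 < μ i)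
    (θ₀ : EuclideanSpace ℝ (Fin p))
    (ξ : Fin n → Ω → EuclideanSpace ℝ (Fin p))
    (hξ : ∀ i, HasLaw (ξ i) (stdGaussian (EuclideanSpace ℝ (Fin p))) P)
    (hindep : iIndepFun ξ P)
    -- the points at which the gradient is evaluated lie in `Θ` (automatic for `Θ = Set.univ`)
    (hΘ : ∀ (z : Fin n → Z) (i : Fin n),
      ∀ᵐ ω ∂P, LDPSGD.iterate Ψ B₀ γ μ θ₀ z (fun j => ξ j ω) i.castSucc ∈ Θ) :
    LDPSGD.IsGDP (Finset.univ.sup' Finset.univ_nonempty μ)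
      (fun z : Fin n → Z => P.map fun ω => LDPSGD.average Ψ B₀ γ μ θ₀ z fun j => ξ j ω) := by
  exact proposition5_general P Θ Ψ hΨ B₀ hB₀ (fun θ hθ z z' => (norm_sub_le _ _).trans
    (by linarith [hbound θ hθ z, hbound θ hθ z'])) γ μ hμ θ₀ ξ hξ hindep hΘ
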